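/- Let $a(n)$, $n\ge 0$, be the integers defined by $$\sum_{n\ge 0} a(n)q^n=\frac{(-q;q)_\infty^2}{(q;q)_\infty}=\prod_{m\ge 1}\frac{(1+q^m)^2}{1-q^m},$$ and put $a(n)=0$ for negative integers $n$. For integers $k\ge 0$ let $$\omega_k=\frac12\left\lceil\frac k2\right\rceil\left\lceil\frac{3k+1}2\right\rceil,$$ so that $(\omega_k)_{k\ge0}=(0,1,2,5,7,12,15,\dots)$ is the sequence of generalized pentagonal numbers, and for $k\in\mathbb Z$ let $g_k=\frac{k(3k-1)}2$. Then for every integer $n\ge 0$ the following hold (all sums have only finitely many nonzero terms): (a) $\displaystyle\sum_{k\ge 0}(-1)^k\,a(2n+1-\omega_k)\equiv 0\pmod 2$; (b) $\displaystyle\sum_{k\in\mathbb Z}(-1)^k\,a(3n+1-2g_k)\equiv 0\pmod 3$; (c) $\displaystyle\sum_{k\in\mathbb Z}(-1)^k\,a(3n+2-2g_k)\equiv 0\pmod 6$; (d) $\displaystyle\sum_{k\in\mathbb Z}(-1)^k\,a(2n+1-3g_k)\equiv 0\pmod 3$. -/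

import Mathlib

open scoped PowerSeries.WithPiTopology

namespace CrankReciprocal

open PowerSeries Filter

/-- The formal product `(q; q)_∞ = ∏_{m ≥ 1} (1 - q ^ m)`, with `q` the variable `X` of `ℤ⟦X⟧`. -/
noncomputable def prodOneSub : ℤ⟦X⟧ := ∏' m : ℕ, (1 - X ^ (m + 1))

/-- The formal product `(-q; q)_∞ = ∏_{m ≥ 1} (1 + q ^ m)`. -/
noncomputable def prodOneAdd : ℤ⟦X⟧ := ∏' m : ℕ, (1 + X ^ (m + 1))

/-- The generating function `(-q; q)_∞ ^ 2 / (q; q)_∞`; the denominator has constant term `1`. -/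
noncomputable def genFun : ℤ⟦X⟧ := prodOneAdd ^ 2 * invOfUnit prodOneSub 1

/-- The sequence `a(n)` with `∑_{n ≥ 0} a(n) q ^ n = (-q; q)_∞ ^ 2 / (q; q)_∞`, extended by
`a(n) = 0` to negative integers `n`. -/
noncomputable def a (n : ℤ) : ℤ := if 0 ≤ n then coeff n.toNat genFun else 0

/-- The generalized pentagonal numbers `0, 1, 2, 5, 7, 12, 15, …` in increasing order,
`ω_k = (1 / 2) ⌈k / 2⌉ ⌈(3 k + 1) / 2⌉`; the division by `2` is exact, see `two_mul_omega`. -/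
def omega (k : ℕ) : ℤ := ⌈(k : ℚ) / 2⌉ * ⌈(3 * (k : ℚ) + 1) / 2⌉ / 2

/-! Both infinite products converge, and the quotient is a genuine one. -/

theorem multipliable_prodOneSub : Multipliable fun m : ℕ => (1 - X ^ (m + 1) : ℤ⟦X⟧) :=
  PowerSeries.WithPiTopology.multipliable_one_sub_X_pow ℤ

theorem multipliable_prodOneAdd : Multipliable fun m : ℕ => (1 + X ^ (m + 1) : ℤ⟦X⟧) := by
  apply PowerSeries.WithPiTopology.multipliable_one_add_of_tendsto_order_atTop_nhds_top
  refine ENat.tendsto_nhds_top_iff_natCast_lt.mpr (fun n => eventually_atTop.mpr ⟨n, ?_⟩)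
  intro m hm
  rw [order_X_pow]
  norm_cast
  exact Nat.lt_add_one_iff.mpr hm

theorem constantCoeff_prodOneSub : constantCoeff prodOneSub = 1 := by
  rw [prodOneSub, multipliable_prodOneSub.map_tprod _
    (PowerSeries.WithPiTopology.continuous_constantCoeff ℤ)]
  simp

theorem prodOneSub_mul_genFun : prodOneSub * genFun = prodOneAdd ^ 2 := by
  have h : prodOneSub * invOfUnit prodOneSub 1 = 1 :=
    mul_invOfUnit _ _ (by simpa using constantCoeff_prodOneSub)
  rw [genFun, mul_left_comm, h, mul_one]

/-! The closed form of `omega` at even and odd indices. -/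

theorem omega_even (n : ℕ) : omega (2 * n) = n * (3 * n + 1) / 2 := by
  have h1 : ⌈((2 * n : ℕ) : ℚ) / 2⌉ = n := by
    rw [Int.ceil_eq_iff]; push_cast; constructor <;> linarith
  have h2 : ⌈(3 * ((2 * n : ℕ) : ℚ) + 1) / 2⌉ = 3 * n + 1 := by
    rw [Int.ceil_eq_iff]; push_cast; constructor <;> linarith
  rw [omega, h1, h2]

theorem omega_odd (n : ℕ) : omega (2 * n + 1) = (n + 1) * (3 * (n + 1) - 1) / 2 := by
  have h1 : ⌈((2 * n + 1 : ℕ) : ℚ) / 2⌉ = n + 1 := by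
    rw [Int.ceil_eq_iff]; push_cast; constructor <;> linarith
  have h2 : ⌈(3 * ((2 * n + 1 : ℕ) : ℚ) + 1) / 2⌉ = 3 * (n + 1) - 1 := by
    rw [Int.ceil_eq_iff]; push_cast; constructor <;> linarith
  rw [omega, h1, h2]

theorem omega_even_eq_pentagonal (n : ℕ) : omega (2 * n) = pentagonal (-(n : ℤ)) := by
  rw [omega_even, natCast_pentagonal]
  congr 1; ring

theorem omega_odd_eq_pentagonal (n : ℕ) : omega (2 * n + 1) = pentagonal ((n : ℤ) + 1) := by
  rw [omega_odd, natCast_pentagonal]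

theorem two_mul_omega (k : ℕ) :
    2 * omega k = ⌈(k : ℚ) / 2⌉ * ⌈(3 * (k : ℚ) + 1) / 2⌉ := by
  obtain ⟨n, rfl | rfl⟩ := k.even_or_odd'
  · have h1 : ⌈((2 * n : ℕ) : ℚ) / 2⌉ = n := by
      rw [Int.ceil_eq_iff]; push_cast; constructor <;> linarith
    have h2 : ⌈(3 * ((2 * n : ℕ) : ℚ) + 1) / 2⌉ = 3 * n + 1 := by
      rw [Int.ceil_eq_iff]; push_cast; constructor <;> linarith
    rw [h1, h2, omega_even_eq_pentagonal, two_mul_natCast_pentagonal_neg]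
  · have h1 : ⌈((2 * n + 1 : ℕ) : ℚ) / 2⌉ = n + 1 := by
      rw [Int.ceil_eq_iff]; push_cast; constructor <;> linarith
    have h2 : ⌈(3 * ((2 * n + 1 : ℕ) : ℚ) + 1) / 2⌉ = 3 * (n + 1) - 1 := by
      rw [Int.ceil_eq_iff]; push_cast; constructor <;> linarith
    rw [h1, h2, omega_odd_eq_pentagonal, two_mul_natCast_pentagonal]

/-! All the sums over `k` have finitely many nonzero terms. -/

theorem le_omega (k : ℕ) : (k : ℤ) ≤ 2 * omega k := by
  obtain ⟨n, rfl | rfl⟩ := k.even_or_odd'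
  · rw [omega_even_eq_pentagonal, two_mul_natCast_pentagonal_neg]
    push_cast
    nlinarith [Int.le_self_sq (n : ℤ)]
  · rw [omega_odd_eq_pentagonal, two_mul_natCast_pentagonal]
    push_cast
    nlinarith [Int.le_self_sq (n : ℤ)]

theorem abs_le_pentagonal (k : ℤ) : |k| ≤ 2 * (pentagonal k : ℤ) := by
  rw [two_mul_natCast_pentagonal, abs_le]
  constructor <;> nlinarith [Int.le_self_sq k, Int.le_self_sq (-k)]

theorem finite_support_omega (e : ℕ → ℤ) (N : ℤ) :
    (Function.support fun k : ℕ => e k * a (N - omega k)).Finite := by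
  refine (Set.finite_Iic (2 * N).toNat).subset fun k hk => ?_
  have h : 0 ≤ N - omega k := by
    by_contra h
    exact hk (by simp only [a, if_neg h, mul_zero])
  have := le_omega k
  simp only [Set.mem_Iic]
  omega

theorem finite_support_pentagonal (e : ℤ → ℤ) (N c : ℤ) (hc : 0 < c) :
    (Function.support fun k : ℤ => e k * a (N - c * pentagonal k)).Finite := by
  refine (Set.finite_Icc (-(2 * N)) (2 * N)).subset fun k hk => ?_
  have h : 0 ≤ N - c * pentagonal k := by
    by_contra h
    exact hk (by simp only [a, if_neg h, mul_zero])
  have h1 := abs_le_pentagonal k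
  have h2 : (pentagonal k : ℤ) ≤ c * pentagonal k := by
    nlinarith [Int.natCast_nonneg (pentagonal k)]
  rw [Set.mem_Icc, ← abs_le]
  linarith

end CrankReciprocal

namespace CrankReciprocal

open PowerSeries

/-! ### Coefficient extraction from the pentagonal series. -/

section Series

variable (R : Type*) [CommRing R]

/-! Write P = (q;q)_∞, A = (-q;q)_∞, G = A²/P. By Euler's pentagonal number theorem each sum is a
coefficient of P(q^c) G (`finsum_pentagonal_eq_coeff`); in (a) this holds only mod 2. Here P G = A²,
and P A = P(q²) gives P(q²) G = A³. Modulo a prime p, p-th powers are series in q^p, which settles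
(a), (b) and (c) mod 3. For (d), P(q³) G ≡ P³ G = P(q²)² mod 3, a series in q². For (c) mod 2, A ≡
P, so A³ ≡ P(q) P(q²), whose coefficients at 3n + 2 vanish mod 2 by an involution
(`coeff_pentagonalSeries_mul_expand_two`). -/

theorem map_pentagonalSeries {S : Type*} [CommRing S] (f : R →+* S) :
    (pentagonalSeries R).map f = pentagonalSeries S := by
  ext n
  rw [coeff_map]
  by_cases h : n ∈ Set.range pentagonal
  · obtain ⟨k, rfl⟩ := h
    simp
  · rw [coeff_pentagonalSeries_eq_zero R h, coeff_pentagonalSeries_eq_zero S h, map_zero]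

/-- The partial sum over `|k| ≤ 2 N` of `∑ (-1) ^ k q ^ (c g_k)`. -/
noncomputable def pentagonalTrunc (c N : ℕ) : R⟦X⟧ :=
  ∑ k ∈ Finset.Icc (-(2 * N : ℤ)) (2 * N), C ((k.negOnePow : ℤ) : R) * X ^ (c * pentagonal k)

variable {R}

theorem mem_Icc_of_pentagonal_le {k : ℤ} {N : ℕ} (h : pentagonal k ≤ N) :
    k ∈ Finset.Icc (-(2 * N : ℤ)) (2 * N) := by
  have := abs_le_pentagonal k
  rw [Finset.mem_Icc, ← abs_le]
  omega

/-- Since |k| ≤ 2 g_k, the window |k| ≤ 2 N contains every k with c g_k ≤ N. -/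
theorem coeff_pentagonalTrunc {c N i : ℕ} (hc : c ≠ 0) (hi : i ≤ N) :
    coeff i (pentagonalTrunc R c N) = coeff i (expand c hc (pentagonalSeries R)) := by
  rw [pentagonalTrunc, map_sum, coeff_expand]
  simp_rw [coeff_C_mul, coeff_X_pow]
  by_cases h : ∃ k, c * pentagonal k = i
  · obtain ⟨k, rfl⟩ := h
    rw [if_pos (dvd_mul_right _ _), Nat.mul_div_cancel_left _ (Nat.pos_of_ne_zero hc),
      coeff_pentagonalSeries_pentagonal, Finset.sum_eq_single k]
    · simp
    · intro b _ hb
      rw [if_neg, mul_zero]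
      intro h
      exact hb (pentagonal_injective (Nat.eq_of_mul_eq_mul_left (Nat.pos_of_ne_zero hc) h)).symm
    · intro hk
      exact absurd (mem_Icc_of_pentagonal_le
        ((Nat.le_mul_of_pos_left _ (Nat.pos_of_ne_zero hc)).trans hi)) hk
  · push Not at h
    rw [Finset.sum_eq_zero fun k _ => by rw [if_neg (h k).symm, mul_zero]]
    split_ifs with hd
    · obtain ⟨t, rfl⟩ := hd
      rw [Nat.mul_div_cancel_left _ (Nat.pos_of_ne_zero hc), coeff_pentagonalSeries_eq_zero]
      rintro ⟨k, rfl⟩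
      exact h k rfl
    · rfl

theorem coeff_mul_congr {f g f' g' : R⟦X⟧} {N : ℕ} (hf : ∀ i ≤ N, coeff i f = coeff i f')
    (hg : ∀ i ≤ N, coeff i g = coeff i g') : coeff N (f * g) = coeff N (f' * g') := by
  simp_rw [coeff_mul]
  refine Finset.sum_congr rfl fun p hp => ?_
  have := Finset.HasAntidiagonal.mem_antidiagonal.mp hp
  rw [hf _ (by omega), hg _ (by omega)]

theorem coeff_expand_pentagonalSeries_mul {c : ℕ} (hc : c ≠ 0) (F : R⟦X⟧) (N : ℕ) :
    coeff N (expand c hc (pentagonalSeries R) * F) =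
      ∑ k ∈ Finset.Icc (-(2 * N : ℤ)) (2 * N), ((k.negOnePow : ℤ) : R) *
        if c * pentagonal k ≤ N then coeff (N - c * pentagonal k) F else 0 := by
  rw [coeff_mul_congr (fun i hi => (coeff_pentagonalTrunc hc hi).symm) (fun _ _ => rfl),
    pentagonalTrunc, Finset.sum_mul, map_sum]
  simp_rw [mul_assoc, coeff_C_mul, coeff_X_pow_mul']

end Series

theorem finsum_pentagonal_eq_coeff {c : ℕ} (hc : c ≠ 0) (N : ℕ) :
    ∑ᶠ k : ℤ, (k.negOnePow : ℤ) * a (N - c * pentagonal k) =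
      coeff N (expand c hc (pentagonalSeries ℤ) * genFun) := by
  have ha (k : ℤ) : a (N - c * pentagonal k) =
      if c * pentagonal k ≤ N then coeff (N - c * pentagonal k) genFun else 0 := by
    by_cases h : c * pentagonal k ≤ N
    · rw [a, if_pos h, if_pos (by zify at h; linarith)]
      congr 2
      zify [h]
      rw [Int.toNat_of_nonneg (by zify at h; linarith)]
    · rw [a, if_neg h, if_neg]
      zify at h
      linarith
  rw [coeff_expand_pentagonalSeries_mul, finsum_eq_sum_of_support_subset]
  · exact Finset.sum_congr rfl fun k _ => by rw [ha, Int.cast_id]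
  · intro k hk
    rw [Function.mem_support, ha] at hk
    refine mem_Icc_of_pentagonal_le ((Nat.le_mul_of_pos_left _ (Nat.pos_of_ne_zero hc)).trans ?_)
    by_contra h
    exact hk (by rw [if_neg h, mul_zero])

/-- Frobenius fixes the coefficients, as they lie in the prime field. -/
theorem expand_zmod {p : ℕ} [Fact p.Prime] (f : (ZMod p)⟦X⟧) :
    expand p (NeZero.ne p) f = f ^ p := by
  have h := MvPowerSeries.map_frobenius_expand p (NeZero.ne p) (f := f)
  rw [ZMod.frobenius_zmod, MvPowerSeries.map_id] at h
  exact h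

/-! Product identities. -/

theorem prodOneSub_eq : prodOneSub = pentagonalSeries ℤ :=
  PowerSeries.WithPiTopology.tprod_one_sub_X_pow ℤ

theorem continuous_expand {c : ℕ} (hc : c ≠ 0) :
    Continuous (expand c hc : ℤ⟦X⟧ → ℤ⟦X⟧) := by
  rw [continuous_iff_continuousAt]
  intro f
  rw [ContinuousAt, PowerSeries.WithPiTopology.tendsto_iff_coeff_tendsto]
  intro d
  simp_rw [coeff_expand]
  split_ifs
  · exact (PowerSeries.WithPiTopology.continuous_coeff ℤ _).tendsto f
  · exact tendsto_const_nhds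

/-- Factorwise (1 - q^m)(1 + q^m) = 1 - q^(2m); continuity carries q ↦ q² through the infinite
product. -/
theorem prodOneSub_mul_prodOneAdd : prodOneSub * prodOneAdd = expand 2 two_ne_zero prodOneSub := by
  rw [prodOneSub, prodOneAdd, multipliable_prodOneSub.map_tprod _ (continuous_expand two_ne_zero),
    ← multipliable_prodOneSub.tprod_mul multipliable_prodOneAdd]
  refine tprod_congr fun m => ?_
  simp only [map_sub, map_one, map_pow, expand_X]
  ring

theorem expand_two_mul_genFun :
    expand 2 two_ne_zero (pentagonalSeries ℤ) * genFun = prodOneAdd ^ 3 := by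
  rw [← prodOneSub_eq, ← prodOneSub_mul_prodOneAdd, mul_right_comm, prodOneSub_mul_genFun,
    ← pow_succ]

theorem prodOneSub_cube_mul_genFun :
    prodOneSub ^ 3 * genFun = expand 2 two_ne_zero (prodOneSub ^ 2) := by
  rw [map_pow, ← prodOneSub_mul_prodOneAdd, mul_pow, ← prodOneSub_mul_genFun, ← mul_assoc,
    ← pow_succ]

theorem intCast_coeff (R : Type*) [CommRing R] (f : ℤ⟦X⟧) (N : ℕ) :
    ((coeff N f : ℤ) : R) = coeff N (f.map (Int.castRingHom R)) := by
  simp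

theorem map_expand_pentagonalSeries {p : ℕ} [Fact p.Prime] :
    (expand p (NeZero.ne p) (pentagonalSeries ℤ)).map (Int.castRingHom (ZMod p)) =
      prodOneSub.map (Int.castRingHom (ZMod p)) ^ p := by
  rw [map_expand, expand_zmod, prodOneSub_eq]

theorem map_expand_three_mul_genFun :
    (expand 3 three_ne_zero (pentagonalSeries ℤ) * genFun).map (Int.castRingHom (ZMod 3)) =
      (expand 2 two_ne_zero (prodOneSub ^ 2)).map (Int.castRingHom (ZMod 3)) := by
  rw [map_mul, map_expand_pentagonalSeries, ← map_pow, ← map_mul, prodOneSub_cube_mul_genFun]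

/-- Modulo a prime `p`, a `p`-th power of a series is a series in `q ^ p`. -/
theorem prime_dvd_coeff_pow {p : ℕ} [Fact p.Prime] (f : ℤ⟦X⟧) {N : ℕ} (h : ¬ p ∣ N) :
    (p : ℤ) ∣ coeff N (f ^ p) := by
  rw [← ZMod.intCast_zmod_eq_zero_iff_dvd, intCast_coeff, map_pow, ← expand_zmod,
    coeff_expand_of_not_dvd _ _ _ h]

theorem map_prodOneAdd_two :
    prodOneAdd.map (Int.castRingHom (ZMod 2)) = pentagonalSeries (ZMod 2) := by
  have h := congrArg (PowerSeries.map (Int.castRingHom (ZMod 2))) prodOneSub_mul_prodOneAdd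
  have h0 : pentagonalSeries (ZMod 2) ≠ 0 := fun h => by
    have := coeff_pentagonalSeries_pentagonal (ZMod 2) 0
    simp [h] at this
  rw [map_mul, map_expand, expand_zmod, prodOneSub_eq, map_pentagonalSeries, sq] at h
  exact mul_left_cancel₀ h0 h

/-! The coefficients of `q ^ (3 n + 2)` in `(q; q)_∞ (q²; q²)_∞` are even: the solutions of
`g_i + 2 g_j = 3 n + 2` are paired off by `(i, j) ↦ ((i - 4 j + 1) / 3, (1 - 2 i - j) / 3)`, an
involution without fixed points. -/

theorem pentagonal_add_eq_iff {i j : ℤ} {N : ℕ} :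
    pentagonal i + 2 * pentagonal j = N ↔ i * (3 * i - 1) + 2 * (j * (3 * j - 1)) = 2 * N := by
  rw [← two_mul_natCast_pentagonal, ← two_mul_natCast_pentagonal]
  omega

theorem exists_eq_add_of_pentagonal_add_eq {i j : ℤ} {n : ℕ}
    (h : pentagonal i + 2 * pentagonal j = 3 * n + 2) : ∃ t, i = j + 3 * t + 2 := by
  rw [pentagonal_add_eq_iff] at h
  push_cast at h
  -- The equation reads j - i ≡ 1 mod 3; this makes the divisions by 3 in the involution exact.
  exact ⟨i * i + 2 * (j * j) - j - 2 * n - 2, by linarith⟩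

theorem coeff_pentagonalSeries_mul_expand_two (n : ℕ) :
    coeff (3 * n + 2) (pentagonalSeries (ZMod 2) *
      expand 2 two_ne_zero (pentagonalSeries (ZMod 2))) = 0 := by
  have hsign (k : ℤ) : ((k.negOnePow : ℤ) : ZMod 2) = 1 := by
    rcases Int.even_or_odd k with hk | hk
    · simp [Int.negOnePow_even k hk]
    · rw [Int.negOnePow_odd k hk]; decide
  have h1 (i : ℕ) (hi : i ≤ 3 * n + 2) : coeff i (pentagonalSeries (ZMod 2)) =
      coeff i (pentagonalTrunc (ZMod 2) 1 (3 * n + 2)) := by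
    rw [coeff_pentagonalTrunc one_ne_zero hi, expand_one_apply]
  rw [coeff_mul_congr h1 fun i hi => (coeff_pentagonalTrunc two_ne_zero hi).symm,
    pentagonalTrunc, pentagonalTrunc, Finset.sum_mul_sum, ← Finset.sum_product', map_sum]
  simp only [hsign, map_one, one_mul, ← pow_add, coeff_X_pow]
  rw [← Finset.sum_filter]
  -- With x = 6 i - 1, y = 6 j - 1 the equation is x² + 2 y² = 72 n + 51, and the map is the
  -- isometry (x, y) ↦ ((x - 4 y) / 3, -(2 x + y) / 3) of this form.
  refine Finset.sum_involution
    (fun x _ => ((x.1 - 4 * x.2 + 1) / 3, (1 - 2 * x.1 - x.2) / 3)) (fun _ _ => by decide) ?_ ?_ ?_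
  · rintro ⟨i, j⟩ h - heq
    obtain ⟨t, rfl⟩ := exists_eq_add_of_pentagonal_add_eq (i := i) (j := j)
      (Finset.mem_filter.mp h).2.symm
    simp only [Prod.mk.injEq] at heq
    -- A fixed point would force 2 (j + t) = -1.
    omega
  · rintro ⟨i, j⟩ h
    have hN : pentagonal i + 2 * pentagonal j = 3 * n + 2 := (Finset.mem_filter.mp h).2.symm
    obtain ⟨t, rfl⟩ := exists_eq_add_of_pentagonal_add_eq hN
    have e1 : (j + 3 * t + 2 - 4 * j + 1) / 3 = t - j + 1 := by omega
    have e2 : (1 - 2 * (j + 3 * t + 2) - j) / 3 = -j - 2 * t - 1 := by omega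
    have hN' : pentagonal (t - j + 1) + 2 * pentagonal (-j - 2 * t - 1) = 3 * n + 2 := by
      rw [pentagonal_add_eq_iff] at hN ⊢
      rw [← hN]
      ring
    simp only [e1, e2, Finset.mem_filter, Finset.mem_product]
    exact ⟨⟨mem_Icc_of_pentagonal_le (by omega), mem_Icc_of_pentagonal_le (by omega)⟩, hN'.symm⟩
  · rintro ⟨i, j⟩ h
    obtain ⟨t, rfl⟩ := exists_eq_add_of_pentagonal_add_eq (i := i) (j := j)
      (Finset.mem_filter.mp h).2.symm
    simp only [Prod.mk.injEq]
    omega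

theorem two_dvd_coeff_prodOneAdd_cube (n : ℕ) : (2 : ℤ) ∣ coeff (3 * n + 2) (prodOneAdd ^ 3) := by
  have h := coeff_pentagonalSeries_mul_expand_two n
  rw [expand_zmod, ← pow_succ', ← map_prodOneAdd_two, ← map_pow, ← intCast_coeff] at h
  exact (ZMod.intCast_zmod_eq_zero_iff_dvd _ 2).mp h

/-! The enumeration `0, 1, -1, 2, -2, …` of the integers matching `omega` with `pentagonal`. -/

theorem exists_equiv_omega_eq_pentagonal :
    ∃ e : ℕ ≃ ℤ, ∀ k, omega k = pentagonal (e k) := by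
  let f : ℕ → ℤ := fun k => if k % 2 = 0 then -((k / 2 : ℕ) : ℤ) else (k / 2 : ℕ) + 1
  have hf : Function.Bijective f := by
    constructor
    · intro x y h
      simp only [f] at h
      split_ifs at h <;> omega
    · intro z
      rcases le_or_gt z 0 with hz | hz
      · refine ⟨2 * (-z).toNat, ?_⟩
        simp only [f]
        split_ifs <;> omega
      · refine ⟨2 * (z - 1).toNat + 1, ?_⟩
        simp only [f]
        split_ifs <;> omega
  refine ⟨Equiv.ofBijective f hf, fun k => ?_⟩
  rw [Equiv.ofBijective_apply]
  obtain ⟨n, rfl | rfl⟩ := k.even_or_odd'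
  · rw [omega_even_eq_pentagonal, show f (2 * n) = -(n : ℤ) by simp [f]]
  · have hfn : f (2 * n + 1) = (n : ℤ) + 1 := by
      simp only [f]
      split_ifs <;> omega
    rw [omega_odd_eq_pentagonal, hfn]

/-- In (a) the sign (-1)^k follows the position in the enumeration, not the pentagonal index; mod 2
any odd weights are interchangeable. -/
theorem two_dvd_finsum_sub_finsum {ι : Type*} {d e b : ι → ℤ} (hd : ∀ k, Odd (d k))
    (he : ∀ k, Odd (e k)) (h₁ : (Function.support fun k => d k * b k).Finite)
    (h₂ : (Function.support fun k => e k * b k).Finite) :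
    (2 : ℤ) ∣ ∑ᶠ k, d k * b k - ∑ᶠ k, e k * b k := by
  rw [← finsum_sub_distrib h₁ h₂]
  refine finsum_induction (fun x : ℤ => 2 ∣ x) (dvd_zero _) (fun _ _ => dvd_add) fun k => ?_
  rw [← sub_mul]
  exact ((hd k).sub_odd (he k)).two_dvd.mul_right _

theorem odd_negOnePow (k : ℤ) : Odd (k.negOnePow : ℤ) := by
  rcases Int.even_or_odd k with hk | hk
  · simp [Int.negOnePow_even k hk]
  · simp [Int.negOnePow_odd k hk]

theorem finsum_omega_modEq (N : ℕ) :
    ∑ᶠ k : ℕ, (-1 : ℤ) ^ k * a (N - omega k) ≡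
      coeff N (pentagonalSeries ℤ * genFun) [ZMOD 2] := by
  obtain ⟨e, he⟩ := exists_equiv_omega_eq_pentagonal
  have h : ∑ᶠ k : ℕ, ((e k).negOnePow : ℤ) * a (N - omega k) =
      coeff N (pentagonalSeries ℤ * genFun) := by
    have := finsum_pentagonal_eq_coeff one_ne_zero N
    rw [expand_one_apply, ← finsum_comp_equiv e] at this
    simpa only [he, Nat.cast_one, one_mul] using this
  rw [← h]
  exact (Int.modEq_iff_dvd.mpr (two_dvd_finsum_sub_finsum (fun k => odd_negOnePow (e k))
    (fun k => (odd_neg_one.pow)) (finite_support_omega _ N) (finite_support_omega _ N)))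

end CrankReciprocal

open CrankReciprocal PowerSeries in
theorem mainTheorem10 (n : ℕ) :
    ((∑ᶠ k : ℕ, (-1 : ℤ) ^ k * CrankReciprocal.a (2 * n + 1 - CrankReciprocal.omega k))
        ≡ 0 [ZMOD 2]) ∧
    ((∑ᶠ k : ℤ, (k.negOnePow : ℤ) * CrankReciprocal.a (3 * n + 1 - 2 * pentagonal k))
        ≡ 0 [ZMOD 3]) ∧
    ((∑ᶠ k : ℤ, (k.negOnePow : ℤ) * CrankReciprocal.a (3 * n + 2 - 2 * pentagonal k))
        ≡ 0 [ZMOD 6]) ∧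
    ((∑ᶠ k : ℤ, (k.negOnePow : ℤ) * CrankReciprocal.a (2 * n + 1 - 3 * pentagonal k))
        ≡ 0 [ZMOD 3]) := by
  have hb := finsum_pentagonal_eq_coeff two_ne_zero (3 * n + 1)
  have hc := finsum_pentagonal_eq_coeff two_ne_zero (3 * n + 2)
  have hd := finsum_pentagonal_eq_coeff three_ne_zero (2 * n + 1)
  have ha := finsum_omega_modEq (2 * n + 1)
  rw [expand_two_mul_genFun] at hb hc
  push_cast at ha hb hc hd
  rw [hb, hc, hd]
  refine ⟨ha.trans ?_, ?_, ?_, ?_⟩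
  · rw [← prodOneSub_eq, prodOneSub_mul_genFun, Int.modEq_zero_iff_dvd]
    exact prime_dvd_coeff_pow (p := 2) _ (by omega)
  · exact Int.modEq_zero_iff_dvd.mpr (prime_dvd_coeff_pow (p := 3) _ (by omega))
  · have h2 := two_dvd_coeff_prodOneAdd_cube n
    have h3 : (3 : ℤ) ∣ _ := prime_dvd_coeff_pow (p := 3) prodOneAdd
      (show ¬ 3 ∣ 3 * n + 2 by omega)
    rw [Int.modEq_zero_iff_dvd]
    omega
  · rw [Int.modEq_zero_iff_dvd]
    refine (ZMod.intCast_zmod_eq_zero_iff_dvd _ 3).mp ?_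
    rw [intCast_coeff, map_expand_three_mul_genFun, ← intCast_coeff,
      coeff_expand_of_not_dvd _ _ _ (by omega), Int.cast_zero]
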